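/- Fix an integer $k\ge 1$. Let $J^k(\mathbb R)=\mathbb R^{k+2}$, with points written $(x,u_k,\ldots,u_0)$, be equipped with the group law $(x,u_k,\ldots,u_0)\odot(y,v_k,\ldots,v_0)=(x+y,w_k,\ldots,w_0)$, where $$w_s=u_s+v_s+\sum_{j=s+1}^k u_j\frac{y^{j-s}}{(j-s)!},\qquad s=0,\ldots,k,$$ and with the Carnot–Carathéodory metric $d_{cc}$: $d_{cc}(p,q)$ is the infimum of the lengths of horizontal curves from $p$ to $q$, i.e. of absolutely continuous curves in $\mathbb R^{k+2}$ whose derivative is almost everywhere annihilated by the contact forms $du_j-u_{j+1}\,dx$, $0\le j\le k-1$, the length being $\int\sqrt{(x')^2+(u_k')^2}$. Hausdorff dimension and compactness in $J^k(\mathbb R)$ are taken with respect to $d_{cc}$. For $f\in C^\infty(\mathbb R)$ put $j^k_x(f)=(x,f^{(k)}(x),\ldots,f'(x),f(x))$, and for $t\in\mathbb R$ and $p=(x,u_k,\ldots,u_0)\in J^k(\mathbb R)$ put $$J_{f,t}(p)=j^k_{x-t}(f),\qquad V_{f,t}(p)=p\odot j^k_{x-t}(f)^{-1}.$$ Let $t\in\mathbb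 R$, $f\in C^\infty(\mathbb R)$, $0\le\alpha\le 1$, and let $E_\alpha\subset\mathbb R$ be a compact set with $\dim_H E_\alpha=\alpha$. Then for every $p\in J^k(\mathbb R)$ whose first coordinate is $t$, the set $$p\odot j^k(f)(E_\alpha):=\{p\odot j^k_x(f):x\in E_\alpha\}\subset J^k(\mathbb R)$$ is compact and satisfies $$\dim_H J_{f,t}\bigl(p\odot j^k(f)(E_\alpha)\bigr)=\alpha\qquad\text{and}\qquad \dim_H V_{f,t}\bigl(p\odot j^k(f)(E_\alpha)\bigr)=0.$$ Moreover, if $E_\alpha\neq\emptyset$, then $V_{f,t}\bigl(p\odot j^k(f)(E_\alpha)\bigr)=\{p\}$. -/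

import Mathlib

open MeasureTheory Set
open scoped ENNReal NNReal ContDiff

/-- The jet space `J^k(ℝ)`, identified with `ℝ^{k+2}`: the point `(x, u_k, …, u_0)` has base point
`x` and coordinates `u s`, `s = 0, …, k`. -/
@[ext] structure JetSpace (k : ℕ) where
  x : ℝ
  u : Fin (k + 1) → ℝ

namespace JetSpace

noncomputable section

variable {k : ℕ}

/-! ### The Carnot group law -/

/-- `(x, u) ⊙ (y, v) = (x + y, w)` with
`w_s = u_s + v_s + ∑_{j = s+1}^k u_j y^(j-s) / (j-s)!`. -/
instance instMul : Mul (JetSpace k) where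
  mul p q :=
    { x := p.x + q.x
      u := fun s => p.u s + q.u s +
        ∑ j ∈ Finset.Ioi s,
          p.u j * (q.x ^ ((j : ℕ) - (s : ℕ)) / (Nat.factorial ((j : ℕ) - (s : ℕ)) : ℝ)) }

instance instOne : One (JetSpace k) where
  one := { x := 0, u := fun _ => 0 }

/-- `(x, u)⁻¹ = (-x, w)` with `w_s = - ∑_{j = s}^k u_j (-x)^(j-s) / (j-s)!`. -/
instance instInv : Inv (JetSpace k) where
  inv p :=
    { x := -p.x
      u := fun s => -∑ j ∈ Finset.Ici s,
        p.u j * ((-p.x) ^ ((j : ℕ) - (s : ℕ)) / (Nat.factorial ((j : ℕ) - (s : ℕ)) : ℝ)) }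

/-- Translation by `y` of the Taylor coefficients `u`. -/
def shift (y : ℝ) (u : Fin (k + 1) → ℝ) (s : Fin (k + 1)) : ℝ :=
  ∑ j ∈ Finset.Ici s, u j * (y ^ ((j : ℕ) - (s : ℕ)) / (Nat.factorial ((j : ℕ) - (s : ℕ)) : ℝ))

theorem mul_x (p q : JetSpace k) : (p * q).x = p.x + q.x := rfl

theorem mul_u (p q : JetSpace k) : (p * q).u = fun s => shift q.x p.u s + q.u s := by
  funext s
  change p.u s + q.u s + _ = shift q.x p.u s + q.u s
  unfold shift
  rw [← Finset.Ioi_insert s, Finset.sum_insert (by simp)]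
  simp
  ring

theorem one_x : (1 : JetSpace k).x = 0 := rfl

theorem one_u : (1 : JetSpace k).u = fun _ => 0 := rfl

theorem inv_x (p : JetSpace k) : (p⁻¹).x = -p.x := rfl

theorem inv_u (p : JetSpace k) : (p⁻¹).u = fun s => -shift (-p.x) p.u s := rfl

theorem shift_zero (u : Fin (k + 1) → ℝ) (s : Fin (k + 1)) : shift 0 u s = u s := by
  unfold shift
  rw [Finset.sum_eq_single s]
  · simp
  · intro j hj hne
    have h1 : s ≤ j := Finset.mem_Ici.1 hj
    have h2 : s < j := lt_of_le_of_ne h1 (Ne.symm hne)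
    have h3 : (j : ℕ) - (s : ℕ) ≠ 0 := by
      have : (s : ℕ) < (j : ℕ) := h2
      omega
    simp [h3]
  · simp

theorem shift_add_right (y : ℝ) (u v : Fin (k + 1) → ℝ) (s : Fin (k + 1)) :
    shift y (fun i => u i + v i) s = shift y u s + shift y v s := by
  simp [shift, add_mul, Finset.sum_add_distrib]

theorem shift_neg_right (y : ℝ) (u : Fin (k + 1) → ℝ) (s : Fin (k + 1)) :
    shift y (fun i => -u i) s = -shift y u s := by
  simp [shift]

theorem shift_const_zero (y : ℝ) (s : Fin (k + 1)) :
    shift y (fun _ : Fin (k + 1) => (0 : ℝ)) s = 0 := by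
  simp [shift]

theorem sum_binomial (y z : ℝ) (s j : Fin (k + 1)) (h : s ≤ j) :
    ∑ i ∈ Finset.Icc s j,
      (y ^ ((j : ℕ) - (i : ℕ)) / (Nat.factorial ((j : ℕ) - (i : ℕ)) : ℝ)) *
      (z ^ ((i : ℕ) - (s : ℕ)) / (Nat.factorial ((i : ℕ) - (s : ℕ)) : ℝ)) =
    (y + z) ^ ((j : ℕ) - (s : ℕ)) / (Nat.factorial ((j : ℕ) - (s : ℕ)) : ℝ) := by
  have hsj : (s : ℕ) ≤ (j : ℕ) := h
  rw [add_comm y z, add_pow, Finset.sum_div]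
  refine Finset.sum_bij' (fun i _ => (i : ℕ) - (s : ℕ))
    (fun m hm => ⟨m + (s : ℕ), ?_⟩) ?_ ?_ ?_ ?_ ?_
  · have := Finset.mem_range.1 hm
    have := j.2
    omega
  · intro i hi
    obtain ⟨h1, h2⟩ := Finset.mem_Icc.1 hi
    have h1' : (s : ℕ) ≤ (i : ℕ) := h1
    have h2' : (i : ℕ) ≤ (j : ℕ) := h2
    rw [Finset.mem_range]
    omega
  · intro m hm
    have := Finset.mem_range.1 hm
    rw [Finset.mem_Icc, Fin.le_def, Fin.le_def]
    constructor
    · change (s : ℕ) ≤ m + s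
      omega
    · change m + (s : ℕ) ≤ j
      omega
  · intro i hi
    obtain ⟨h1, h2⟩ := Finset.mem_Icc.1 hi
    have h1' : (s : ℕ) ≤ (i : ℕ) := h1
    apply Fin.ext
    change (i : ℕ) - s + s = i
    omega
  · intro m hm
    change m + (s : ℕ) - s = m
    omega
  · intro i hi
    obtain ⟨h1, h2⟩ := Finset.mem_Icc.1 hi
    have h1' : (s : ℕ) ≤ (i : ℕ) := h1
    have h2' : (i : ℕ) ≤ (j : ℕ) := h2
    have e : (j : ℕ) - s - (i - s) = j - i := by omega
    rw [Nat.cast_choose ℝ (by omega : (i : ℕ) - s ≤ j - s), e]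
    have a1 : (Nat.factorial ((j : ℕ) - (i : ℕ)) : ℝ) ≠ 0 := by positivity
    have a2 : (Nat.factorial ((i : ℕ) - (s : ℕ)) : ℝ) ≠ 0 := by positivity
    have a3 : (Nat.factorial ((j : ℕ) - (s : ℕ)) : ℝ) ≠ 0 := by positivity
    field_simp

theorem shift_shift (y z : ℝ) (u : Fin (k + 1) → ℝ) (s : Fin (k + 1)) :
    shift z (fun i => shift y u i) s = shift (y + z) u s := by
  unfold shift
  simp_rw [Finset.sum_mul]
  rw [Finset.sum_comm' (t' := Finset.Ici s) (s' := fun j => Finset.Icc s j)]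
  · refine Finset.sum_congr rfl fun j hj => ?_
    rw [← sum_binomial y z s j (Finset.mem_Ici.1 hj), Finset.mul_sum]
    refine Finset.sum_congr rfl fun i _ => ?_
    ring
  · intro i j
    simp only [Finset.mem_Ici, Finset.mem_Icc]
    constructor
    · rintro ⟨h1, h2⟩
      exact ⟨⟨h1, h2⟩, h1.trans h2⟩
    · rintro ⟨⟨h1, h2⟩, _⟩
      exact ⟨h1, h2⟩

instance instGroup : Group (JetSpace k) :=
  Group.ofLeftAxioms
    (by
      intro p q r
      ext s
      · simp only [mul_x]; ring
      · simp only [mul_u, mul_x, shift_add_right, shift_shift]; ring)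
    (by
      intro p
      ext s
      · simp [mul_x, one_x]
      · simp [mul_u, one_u, shift_const_zero])
    (by
      intro p
      ext s
      · simp [mul_x, one_x, inv_x]
      · simp [mul_u, one_u, inv_u, shift_neg_right, shift_shift, shift_zero])

/-! ### The Carnot–Carathéodory metric -/

/-- `γ` is a horizontal curve on `[a, b]`: it is absolutely continuous as a map into `ℝ^{k+2}`
(that is, in each coordinate), and its derivative is a.e. annihilated by the contact forms
`du_j - u_{j+1} dx`, `j = 0, …, k-1`. -/
structure IsHorizontal (γ : ℝ → JetSpace k) (a b : ℝ) : Prop where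
  ac_x : AbsolutelyContinuousOnInterval (fun s => (γ s).x) a b
  ac_u : ∀ j : Fin (k + 1), AbsolutelyContinuousOnInterval (fun s => (γ s).u j) a b
  contact : ∀ j : Fin k, ∀ᵐ t ∂(volume.restrict (Icc a b)),
    deriv (fun s => (γ s).u j.castSucc) t = (γ t).u j.succ * deriv (fun s => (γ s).x) t

/-- The norm of the velocity of a horizontal curve, for the metric on the horizontal bundle in which
`X^(k) = ∂/∂x + u_k ∂/∂u_{k-1} + ⋯ + u_1 ∂/∂u_0` and `∂/∂u_k` are orthonormal: a horizontal vector
equals `x' X^(k) + u_k' ∂/∂u_k`. -/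
def speed (γ : ℝ → JetSpace k) (t : ℝ) : ℝ :=
  Real.sqrt ((deriv (fun s => (γ s).x) t) ^ 2 + (deriv (fun s => (γ s).u (Fin.last k)) t) ^ 2)

/-- The length of a horizontal curve on `[a, b]`. -/
def length (γ : ℝ → JetSpace k) (a b : ℝ) : ℝ≥0∞ :=
  ∫⁻ t in Icc a b, ENNReal.ofReal (speed γ t)

/-- The Carnot–Carathéodory distance: the infimum of the lengths of the horizontal curves
from `p` to `q`. -/
def ccEDist (p q : JetSpace k) : ℝ≥0∞ :=
  ⨅ (γ : ℝ → JetSpace k) (a : ℝ) (b : ℝ) (_ : a ≤ b) (_ : IsHorizontal γ a b)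
    (_ : γ a = p) (_ : γ b = q), length γ a b

theorem ccEDist_le {γ : ℝ → JetSpace k} {a b : ℝ} (hab : a ≤ b) (h : IsHorizontal γ a b) :
    ccEDist (γ a) (γ b) ≤ length γ a b :=
  iInf_le_of_le γ <| iInf_le_of_le a <| iInf_le_of_le b <| iInf_le_of_le hab <|
    iInf_le_of_le h <| iInf_le_of_le rfl <| iInf_le_of_le rfl le_rfl

theorem exists_of_ccEDist_lt {p q : JetSpace k} {r : ℝ≥0∞} (h : ccEDist p q < r) :
    ∃ (γ : ℝ → JetSpace k) (a b : ℝ), a ≤ b ∧ IsHorizontal γ a b ∧ γ a = p ∧ γ b = q ∧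
      length γ a b < r := by
  simp only [ccEDist, iInf_lt_iff] at h
  obtain ⟨γ, a, b, hab, hγ, h1, h2, h3⟩ := h
  exact ⟨γ, a, b, hab, hγ, h1, h2, h3⟩

theorem ccEDist_self (p : JetSpace k) : ccEDist p p = 0 := by
  have hc : ∀ c : ℝ, AbsolutelyContinuousOnInterval (fun _ : ℝ => c) 0 0 := fun c =>
    (contDiff_const (n := 1)).contDiffOn.absolutelyContinuousOnInterval
  have h : IsHorizontal (fun _ : ℝ => p) 0 0 := ⟨hc _, fun _ => hc _, fun j => by simp⟩
  have := ccEDist_le le_rfl h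
  simpa [length] using this

/-- Absolute continuity is stable under precomposition with a monotone `1`-Lipschitz map. -/
theorem ac_comp_of_monotone {f φ : ℝ → ℝ} {a b c d : ℝ} (hf : AbsolutelyContinuousOnInterval f c d)
    (hφ : Monotone φ) (hL : ∀ x y, dist (φ x) (φ y) ≤ dist x y)
    (hm : ∀ x ∈ uIcc a b, φ x ∈ uIcc c d) :
    AbsolutelyContinuousOnInterval (fun t => f (φ t)) a b := by
  rw [absolutelyContinuousOnInterval_iff] at hf ⊢
  intro ε hε
  obtain ⟨δ, hδ, h⟩ := hf ε hε
  refine ⟨δ, hδ, fun E hE hEδ => ?_⟩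
  refine h (E.1, fun i => (φ (E.2 i).1, φ (E.2 i).2)) ⟨?_, ?_⟩ ?_
  · intro i hi
    exact ⟨hm _ (hE.1 i hi).1, hm _ (hE.1 i hi).2⟩
  · intro i hi j hj hij
    have hd := hE.2 hi hj hij
    simp only [Function.onFun, uIoc, Set.Ioc_disjoint_Ioc] at hd ⊢
    rw [← hφ.map_max, ← hφ.map_max, ← hφ.map_min, ← hφ.map_min, ← hφ.map_min, ← hφ.map_max]
    exact hφ hd
  · exact lt_of_le_of_lt (Finset.sum_le_sum fun i _ => hL _ _) hEδ

theorem ac_comp_neg {f : ℝ → ℝ} {a b : ℝ} (hf : AbsolutelyContinuousOnInterval f a b) :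
    AbsolutelyContinuousOnInterval (fun t => f (-t)) (-b) (-a) := by
  rw [absolutelyContinuousOnInterval_iff] at hf ⊢
  intro ε hε
  obtain ⟨δ, hδ, h⟩ := hf ε hε
  refine ⟨δ, hδ, fun E hE hEδ => ?_⟩
  have hm : ∀ x ∈ uIcc (-b) (-a), -x ∈ uIcc a b := by
    intro x hx
    rw [mem_uIcc] at hx ⊢
    rcases hx with hx | hx
    · left; constructor <;> linarith [hx.1, hx.2]
    · right; constructor <;> linarith [hx.1, hx.2]
  refine h (E.1, fun i => (-(E.2 i).1, -(E.2 i).2)) ⟨?_, ?_⟩ ?_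
  · intro i hi
    exact ⟨hm _ (hE.1 i hi).1, hm _ (hE.1 i hi).2⟩
  · intro i hi j hj hij
    have hd := hE.2 hi hj hij
    simp only [Function.onFun, uIoc, Set.Ioc_disjoint_Ioc] at hd ⊢
    simp only [max_neg_neg, min_neg_neg, neg_le_neg_iff]
    grind
  · simpa using hEδ

theorem contact_comp_neg {f g h : ℝ → ℝ} {a b : ℝ}
    (H : ∀ᵐ t ∂(volume.restrict (Icc a b)), deriv f t = g t * deriv h t) :
    ∀ᵐ t ∂(volume.restrict (Icc (-b) (-a))),
      deriv (fun s => f (-s)) t = g (-t) * deriv (fun s => h (-s)) t := by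
  have h0 := (ae_restrict_iff' measurableSet_Icc).1 H
  rw [ae_restrict_iff' measurableSet_Icc]
  have h1 := (Measure.measurePreserving_neg (volume : Measure ℝ)).quasiMeasurePreserving.ae h0
  filter_upwards [h1] with t ht hmem
  have := ht ⟨by linarith [hmem.2], by linarith [hmem.1]⟩
  rw [deriv_comp_neg f t, deriv_comp_neg h t, this]
  ring

theorem IsHorizontal.reverse {γ : ℝ → JetSpace k} {a b : ℝ} (h : IsHorizontal γ a b) :
    IsHorizontal (fun t => γ (-t)) (-b) (-a) :=
  ⟨ac_comp_neg (f := fun s => (γ s).x) h.ac_x,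
    fun j => ac_comp_neg (f := fun s => (γ s).u j) (h.ac_u j),
    fun j => contact_comp_neg (f := fun s => (γ s).u j.castSucc) (g := fun s => (γ s).u j.succ)
      (h := fun s => (γ s).x) (h.contact j)⟩

theorem length_reverse (γ : ℝ → JetSpace k) (a b : ℝ) :
    length (fun t => γ (-t)) (-b) (-a) = length γ a b := by
  unfold length
  have hs : ∀ t, speed (fun t => γ (-t)) t = speed γ (-t) := by
    intro t
    unfold speed
    rw [deriv_comp_neg (fun s => (γ s).u (Fin.last k)) t, deriv_comp_neg (fun s => (γ s).x) t]
    simp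
  simp_rw [hs]
  have := (Measure.measurePreserving_neg (volume : Measure ℝ)).setLIntegral_comp_preimage_emb
    (MeasurableEquiv.neg ℝ).measurableEmbedding (fun t => ENNReal.ofReal (speed γ t)) (Icc a b)
  rw [← this]
  congr 2
  ext t
  simp only [mem_Icc, mem_preimage]
  constructor <;> intro h <;> constructor <;> linarith [h.1, h.2]

theorem ac_comp_add {f : ℝ → ℝ} {a b : ℝ} (hf : AbsolutelyContinuousOnInterval f a b) (c : ℝ) :
    AbsolutelyContinuousOnInterval (fun t => f (t + c)) (a - c) (b - c) := by
  refine ac_comp_of_monotone (φ := fun t => t + c) hf (fun x y hxy => by simpa using hxy)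
    (fun x y => by simp) ?_
  intro x hx
  rw [mem_uIcc] at hx ⊢
  rcases hx with hx | hx
  · left; constructor <;> linarith [hx.1, hx.2]
  · right; constructor <;> linarith [hx.1, hx.2]

theorem contact_comp_add {f g h : ℝ → ℝ} {a b : ℝ}
    (H : ∀ᵐ t ∂(volume.restrict (Icc a b)), deriv f t = g t * deriv h t) (c : ℝ) :
    ∀ᵐ t ∂(volume.restrict (Icc (a - c) (b - c))),
      deriv (fun s => f (s + c)) t = g (t + c) * deriv (fun s => h (s + c)) t := by
  have h0 := (ae_restrict_iff' measurableSet_Icc).1 H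
  rw [ae_restrict_iff' measurableSet_Icc]
  have h1 := (measurePreserving_add_right (volume : Measure ℝ) c).quasiMeasurePreserving.ae h0
  filter_upwards [h1] with t ht hmem
  have := ht ⟨by linarith [hmem.1], by linarith [hmem.2]⟩
  rw [deriv_comp_add_const f c t, deriv_comp_add_const h c t, this]

theorem IsHorizontal.translate {γ : ℝ → JetSpace k} {a b : ℝ} (h : IsHorizontal γ a b) (c : ℝ) :
    IsHorizontal (fun t => γ (t + c)) (a - c) (b - c) :=
  ⟨ac_comp_add (f := fun s => (γ s).x) h.ac_x c,
    fun j => ac_comp_add (f := fun s => (γ s).u j) (h.ac_u j) c,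
    fun j => contact_comp_add (f := fun s => (γ s).u j.castSucc) (g := fun s => (γ s).u j.succ)
      (h := fun s => (γ s).x) (h.contact j) c⟩

theorem length_translate (γ : ℝ → JetSpace k) (a b c : ℝ) :
    length (fun t => γ (t + c)) (a - c) (b - c) = length γ a b := by
  unfold length
  have hs : ∀ t, speed (fun t => γ (t + c)) t = speed γ (t + c) := by
    intro t
    unfold speed
    rw [deriv_comp_add_const (fun s => (γ s).u (Fin.last k)) c t,
      deriv_comp_add_const (fun s => (γ s).x) c t]
  simp_rw [hs]
  have := (measurePreserving_add_right (volume : Measure ℝ) c).setLIntegral_comp_preimage_emb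
    (measurableEmbedding_addRight c) (fun t => ENNReal.ofReal (speed γ t)) (Icc a b)
  rw [← this]
  congr 2
  ext t
  simp only [mem_Icc, mem_preimage]
  constructor <;> intro h <;> constructor <;> linarith [h.1, h.2]

/-- Concatenation of two curves at time `b`. -/
def concat (γ η : ℝ → JetSpace k) (b : ℝ) (t : ℝ) : JetSpace k := if t ≤ b then γ t else η t

theorem ac_concat {f g : ℝ → ℝ} {a b c : ℝ} (hab : a ≤ b) (hbc : b ≤ c)
    (hf : AbsolutelyContinuousOnInterval f a b) (hg : AbsolutelyContinuousOnInterval g b c)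
    (h : f b = g b) :
    AbsolutelyContinuousOnInterval (fun t => if t ≤ b then f t else g t) a c := by
  have h1 : AbsolutelyContinuousOnInterval (fun t => f (min t b)) a c := by
    refine ac_comp_of_monotone (φ := fun t => min t b) hf
      (fun x y hxy => min_le_min_right b hxy) (fun x y => ?_) ?_
    · simpa [Real.dist_eq] using abs_min_sub_min_le_max x b y b
    · intro x hx
      rw [uIcc_of_le (hab.trans hbc)] at hx
      rw [uIcc_of_le hab]
      exact ⟨le_min hx.1 hab, min_le_right _ _⟩
  have h2 : AbsolutelyContinuousOnInterval (fun t => g (max t b)) a c := by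
    refine ac_comp_of_monotone (φ := fun t => max t b) hg
      (fun x y hxy => max_le_max_right b hxy) (fun x y => ?_) ?_
    · simpa [Real.dist_eq] using abs_max_sub_max_le_max x b y b
    · intro x hx
      rw [uIcc_of_le (hab.trans hbc)] at hx
      rw [uIcc_of_le hbc]
      exact ⟨le_max_right _ _, max_le hx.2 hbc⟩
  have h3 : AbsolutelyContinuousOnInterval (fun _ : ℝ => f b) a c :=
    (contDiff_const (n := 1)).contDiffOn.absolutelyContinuousOnInterval
  have h4 : AbsolutelyContinuousOnInterval
      ((fun t => f (min t b)) + (fun t => g (max t b)) - fun _ => f b) a c := (h1.add h2).sub h3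
  suffices he : (fun t => if t ≤ b then f t else g t) =
      (fun t => f (min t b)) + (fun t => g (max t b)) - fun _ => f b by
    rw [he]
    exact h4
  funext t
  by_cases ht : t ≤ b
  · simp [ht, h]
  · have := (not_le.1 ht).le
    simp [ht, this]

theorem concat_eventuallyEq_left (γ η : ℝ → JetSpace k) {b t : ℝ} (ht : t < b) :
    concat γ η b =ᶠ[nhds t] γ := by
  filter_upwards [Iio_mem_nhds ht] with s hs
  simp [concat, (show s < b from hs).le]

theorem concat_eventuallyEq_right (γ η : ℝ → JetSpace k) {b t : ℝ} (ht : b < t) :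
    concat γ η b =ᶠ[nhds t] η := by
  filter_upwards [Ioi_mem_nhds ht] with s hs
  simp [concat, not_le.2 (show b < s from hs)]

theorem deriv_u_congr {δ ε : ℝ → JetSpace k} {t : ℝ} (he : δ =ᶠ[nhds t] ε) (j : Fin (k + 1)) :
    deriv (fun s => (δ s).u j) t = deriv (fun s => (ε s).u j) t :=
  (he.fun_comp (fun p => p.u j)).deriv_eq

theorem deriv_x_congr {δ ε : ℝ → JetSpace k} {t : ℝ} (he : δ =ᶠ[nhds t] ε) :
    deriv (fun s => (δ s).x) t = deriv (fun s => (ε s).x) t :=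
  (he.fun_comp (fun p => p.x)).deriv_eq

theorem IsHorizontal.concat {γ η : ℝ → JetSpace k} {a b c : ℝ} (hab : a ≤ b) (hbc : b ≤ c)
    (hγ : IsHorizontal γ a b) (hη : IsHorizontal η b c) (h : γ b = η b) :
    IsHorizontal (concat γ η b) a c := by
  refine ⟨?_, fun j => ?_, fun j => ?_⟩
  · have := ac_concat hab hbc hγ.ac_x hη.ac_x (by simp [h])
    convert this using 2
    simp only [JetSpace.concat]; split_ifs <;> rfl
  · have := ac_concat hab hbc (hγ.ac_u j) (hη.ac_u j) (by simp [h])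
    convert this using 2
    simp only [JetSpace.concat]; split_ifs <;> rfl
  · have h1 := (ae_restrict_iff' measurableSet_Icc).1 (hγ.contact j)
    have h2 := (ae_restrict_iff' measurableSet_Icc).1 (hη.contact j)
    have h3 : ∀ᵐ t : ℝ, t ≠ b := by simp [ae_iff, measure_singleton]
    rw [ae_restrict_iff' measurableSet_Icc]
    filter_upwards [h1, h2, h3] with t ht1 ht2 ht3 hmem
    rcases lt_or_gt_of_ne ht3 with hlt | hgt
    · have he := concat_eventuallyEq_left γ η hlt
      rw [deriv_u_congr he, deriv_x_congr he, he.eq_of_nhds]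
      exact ht1 ⟨hmem.1, hlt.le⟩
    · have he := concat_eventuallyEq_right γ η hgt
      rw [deriv_u_congr he, deriv_x_congr he, he.eq_of_nhds]
      exact ht2 ⟨hgt.le, hmem.2⟩

theorem length_concat_le (γ η : ℝ → JetSpace k) {a b c : ℝ} (hab : a ≤ b) (hbc : b ≤ c) :
    length (concat γ η b) a c ≤ length γ a b + length η b c := by
  have hs : ∀ (δ ε : ℝ → JetSpace k) (t : ℝ), δ =ᶠ[nhds t] ε → speed δ t = speed ε t := by
    intro δ ε t he
    unfold speed
    rw [deriv_u_congr he, deriv_x_congr he]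
  unfold length
  rw [← Icc_union_Icc_eq_Icc hab hbc]
  refine (lintegral_union_le _ _ _).trans (add_le_add (le_of_eq ?_) (le_of_eq ?_))
  · rw [← restrict_Ioo_eq_restrict_Icc]
    refine setLIntegral_congr_fun measurableSet_Ioo fun t ht => ?_
    simp only [hs _ _ t (concat_eventuallyEq_left γ η ht.2)]
  · rw [← restrict_Ioo_eq_restrict_Icc]
    refine setLIntegral_congr_fun measurableSet_Ioo fun t ht => ?_
    simp only [hs _ _ t (concat_eventuallyEq_right γ η ht.1)]

theorem ccEDist_comm_le (p q : JetSpace k) : ccEDist q p ≤ ccEDist p q := by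
  refine le_of_forall_gt fun r hr => ?_
  obtain ⟨γ, a, b, hab, hγ, rfl, rfl, hlt⟩ := exists_of_ccEDist_lt hr
  have := ccEDist_le (neg_le_neg hab) hγ.reverse
  rw [length_reverse] at this
  simp only [neg_neg] at this
  exact this.trans_lt hlt

theorem ccEDist_triangle (p q r : JetSpace k) : ccEDist p r ≤ ccEDist p q + ccEDist q r := by
  refine ENNReal.le_of_forall_pos_le_add fun ε hε hfin => ?_
  have hε' : (ε / 2 : ℝ≥0∞) ≠ 0 := by simp [hε.ne']
  obtain ⟨h1, h2⟩ := ENNReal.add_lt_top.1 hfin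
  obtain ⟨γ, a, b, hab, hγ, hp, hq, hl⟩ :=
    exists_of_ccEDist_lt (ENNReal.lt_add_right h1.ne hε')
  obtain ⟨η, c, d, hcd, hη, hq', hr, hl'⟩ :=
    exists_of_ccEDist_lt (ENNReal.lt_add_right h2.ne hε')
  have hη2 := hη.translate (c - b)
  have hlen := length_translate η c d (c - b)
  rw [show c - (c - b) = b by ring] at hη2 hlen
  have hbd : b ≤ d - (c - b) := by linarith
  have hb : γ b = (fun t => η (t + (c - b))) b := by
    simp [hq, hq']
  have hcat := hγ.concat hab hbd hη2 hb
  have hle := (ccEDist_le (hab.trans hbd) hcat).trans (length_concat_le _ _ hab hbd)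
  have e1 : concat γ (fun t => η (t + (c - b))) b a = p := by simp [concat, hab, hp]
  have e2 : concat γ (fun t => η (t + (c - b))) b (d - (c - b)) = r := by
    by_cases hdb : d - (c - b) ≤ b
    · have hdb' : d - (c - b) = b := le_antisymm hdb hbd
      have : d = c := by linarith
      subst this
      rw [hdb']
      simp [concat, hq, ← hq', hr]
    · simp [concat, hdb, hr]
  rw [e1, e2, hlen] at hle
  calc ccEDist p r ≤ length γ a b + length η c d := hle
    _ ≤ (ccEDist p q + ε / 2) + (ccEDist q r + ε / 2) := add_le_add hl.le hl'.le
    _ = ccEDist p q + ccEDist q r + (ε / 2 + ε / 2) := by ring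
    _ = ccEDist p q + ccEDist q r + ε := by rw [ENNReal.add_halves]

theorem enorm_sub_le_of_ac {f : ℝ → ℝ} {a b t : ℝ} (hf : AbsolutelyContinuousOnInterval f a b)
    (ht : t ∈ Icc a b) : ‖f t - f a‖ₑ ≤ ∫⁻ s in Icc a b, ‖deriv f s‖ₑ := by
  have hab : a ≤ b := ht.1.trans ht.2
  have hsub : uIcc a t ⊆ uIcc a b := by
    rw [uIcc_of_le ht.1, uIcc_of_le hab]
    exact Icc_subset_Icc_right ht.2
  rw [← (hf.mono hsub).integral_deriv_eq_sub, intervalIntegral.integral_of_le ht.1]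
  refine (enorm_integral_le_lintegral_enorm _).trans (lintegral_mono_set ?_)
  exact Ioc_subset_Icc_self.trans (Icc_subset_Icc_right ht.2)

theorem enorm_le_speed {v w : ℝ} : ‖v‖ₑ ≤ ENNReal.ofReal (Real.sqrt (v ^ 2 + w ^ 2)) := by
  rw [← ofReal_norm, Real.norm_eq_abs]
  exact ENNReal.ofReal_le_ofReal (Real.abs_le_sqrt (by nlinarith [sq_nonneg w]))

theorem enorm_x_sub_le {γ : ℝ → JetSpace k} {a b t : ℝ} (h : IsHorizontal γ a b)
    (ht : t ∈ Icc a b) : ‖(γ t).x - (γ a).x‖ₑ ≤ length γ a b :=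
  (enorm_sub_le_of_ac h.ac_x ht).trans (lintegral_mono fun _ => enorm_le_speed)

theorem exists_enorm_u_sub_le (p : JetSpace k) (j : Fin (k + 1)) :
    ∃ M : ℝ≥0, ∀ (γ : ℝ → JetSpace k) (a b : ℝ), IsHorizontal γ a b → γ a = p →
      length γ a b ≤ 1 → ∀ t ∈ Icc a b, ‖(γ t).u j - p.u j‖ₑ ≤ M * length γ a b := by
  induction j using Fin.reverseInduction with
  | last =>
    refine ⟨1, fun γ a b h hp _ t ht => ?_⟩
    subst hp
    rw [ENNReal.coe_one, one_mul]
    refine (enorm_sub_le_of_ac (h.ac_u (Fin.last k)) ht).trans (lintegral_mono fun s => ?_)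
    simp only [speed]
    rw [add_comm]
    exact enorm_le_speed
  | cast j ih =>
    obtain ⟨M, hM⟩ := ih
    refine ⟨M + ‖p.u j.succ‖₊, fun γ a b h hp hl t ht => ?_⟩
    have hbd : ∀ s ∈ Icc a b, ‖(γ s).u j.succ‖ₑ ≤ ((M + ‖p.u j.succ‖₊ : ℝ≥0) : ℝ≥0∞) := by
      intro s hs
      calc ‖(γ s).u j.succ‖ₑ = ‖((γ s).u j.succ - p.u j.succ) + p.u j.succ‖ₑ := by simp
        _ ≤ ‖(γ s).u j.succ - p.u j.succ‖ₑ + ‖p.u j.succ‖ₑ := enorm_add_le _ _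
        _ ≤ M * 1 + ‖p.u j.succ‖ₑ := by
          gcongr
          exact (hM γ a b h hp hl s hs).trans (by gcongr)
        _ = _ := by rw [mul_one, ENNReal.coe_add]; rfl
    subst hp
    refine (enorm_sub_le_of_ac (h.ac_u j.castSucc) ht).trans ?_
    unfold length
    rw [← lintegral_const_mul' _ _ ENNReal.coe_ne_top]
    refine lintegral_mono_ae ?_
    filter_upwards [h.contact j, ae_restrict_mem measurableSet_Icc] with s hs hmem
    rw [hs, enorm_mul]
    exact mul_le_mul' (hbd s hmem) enorm_le_speed

theorem eq_of_ccEDist_eq_zero {p q : JetSpace k} (h : ccEDist p q = 0) : p = q := by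
  have key : ∀ (v : ℝ) (M : ℝ≥0), (∀ ε : ℝ≥0∞, 0 < ε → ε ≤ 1 → ‖v‖ₑ ≤ M * ε) → v = 0 := by
    intro v M hv
    have h0 : ‖v‖ₑ ≤ 0 := by
      have ht : Filter.Tendsto (fun ε : ℝ≥0∞ => (M : ℝ≥0∞) * ε) (nhdsWithin 0 (Ioi 0))
          (nhds ((M : ℝ≥0∞) * 0)) :=
        (ENNReal.Tendsto.const_mul (nhdsWithin_le_nhds) (Or.inr ENNReal.coe_ne_top))
      rw [mul_zero] at ht
      refine ge_of_tendsto ht ?_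
      filter_upwards [self_mem_nhdsWithin,
        mem_nhdsWithin_of_mem_nhds (Iic_mem_nhds (zero_lt_one' ℝ≥0∞))] with ε h1 h2
      exact hv ε h1 h2
    simpa using h0
  ext j
  · refine (sub_eq_zero.1 (key (q.x - p.x) 1 fun ε h1 _ => ?_)).symm
    obtain ⟨γ, a, b, hab, hγ, rfl, rfl, hl⟩ := exists_of_ccEDist_lt (h.trans_lt h1)
    rw [ENNReal.coe_one, one_mul]
    exact (enorm_x_sub_le hγ (right_mem_Icc.2 hab)).trans hl.le
  · obtain ⟨M, hM⟩ := exists_enorm_u_sub_le p j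
    refine (sub_eq_zero.1 (key (q.u j - p.u j) M fun ε h1 h2 => ?_)).symm
    obtain ⟨γ, a, b, hab, hγ, hp, rfl, hl⟩ := exists_of_ccEDist_lt (h.trans_lt h1)
    exact (hM γ a b hγ hp (hl.le.trans h2) b (right_mem_Icc.2 hab)).trans (by gcongr)

/-- `J^k(ℝ)` carries the Carnot–Carathéodory metric; topology and Hausdorff dimension
are those of this metric. -/
instance instEMetricSpace : EMetricSpace (JetSpace k) where
  edist := ccEDist
  edist_self := ccEDist_self
  edist_comm p q := le_antisymm (ccEDist_comm_le q p) (ccEDist_comm_le p q)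
  edist_triangle := ccEDist_triangle
  eq_of_edist_eq_zero := eq_of_ccEDist_eq_zero

/-! ### Jets, vertical and horizontal mappings -/

/-- The jet `j^k_x(f) = (x, f^(k)(x), …, f(x))`. -/
def jet (k : ℕ) (f : ℝ → ℝ) (x : ℝ) : JetSpace k where
  x := x
  u := fun j => iteratedDeriv (j : ℕ) f x

/-- The vertical mapping `V_{f,t}(p) = p ⊙ j^k_{x-t}(f)⁻¹`, where `x` is the first coordinate
of `p`. -/
def verticalMap (f : ℝ → ℝ) (t : ℝ) (p : JetSpace k) : JetSpace k :=
  p * (jet k f (p.x - t))⁻¹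

/-- The horizontal mapping `J_{f,t}(p) = j^k_{x-t}(f)`, where `x` is the first coordinate
of `p`. -/
def horizontalMap (f : ℝ → ℝ) (t : ℝ) (p : JetSpace k) : JetSpace k :=
  jet k f (p.x - t)

/-- The plane `{x = t}`. -/
def plane (k : ℕ) (t : ℝ) : Set (JetSpace k) := {p | p.x = t}

end

end JetSpace

/-! Since `p` has first coordinate `t`, the point `p ⊙ j^k_x(f)` has base point `t + x`. Hence
`J_{f,t}` sends it to `j^k_x(f)`, and `V_{f,t}` cancels that same jet and returns `p`. The vertical
image is therefore contained in `{p}`, and the horizontal image is `j^k(f)(E)`.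

It remains to see that `x ↦ j^k_x(f)` preserves the dimension of a compact set. The jet curve is
itself horizontal, because each coordinate is the derivative of the one before it, and its speed is
continuous. It is thus a competitor in the definition of `d_cc`, which makes it Lipschitz on compact
intervals (`exists_lipschitzOnWith_Icc`). Its left inverse, the projection to the base point, is
1-Lipschitz because length dominates `∫ |x'|` (`lipschitzWith_x`). The Lipschitz bound, applied to
the translated curve `x ↦ p ⊙ j^k_x(f)`, also gives compactness. -/

namespace JetSpace

variable {k : ℕ}

/-! ### Jet curves are Lipschitz for the Carnot–Carathéodory metric -/

/-- A `C^1` curve that is parametrized by its base point up to a translation, and on which each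
coordinate is the derivative of the preceding one, is Lipschitz on compact intervals. -/
theorem exists_lipschitzOnWith_Icc {γ : ℝ → JetSpace k} {c : ℝ} (hx : ∀ s, (γ s).x = c + s)
    (hu : ∀ j, ContDiff ℝ 1 fun s => (γ s).u j)
    (hd : ∀ (j : Fin k) (s : ℝ), HasDerivAt (fun s => (γ s).u j.castSucc) ((γ s).u j.succ) s)
    (a b : ℝ) : ∃ K : ℝ≥0, LipschitzOnWith K γ (Icc a b) := by
  have hxd : ∀ s, deriv (fun s => (γ s).x) s = 1 := fun s => by
    simp only [hx]
    simp
  -- As `x' = 1`, the contact condition is just `u_j' = u_{j+1}`, which holds everywhere.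
  have hhor : ∀ a b, IsHorizontal γ a b := fun a b =>
    { ac_x := by
        simp only [hx]
        exact (contDiff_const.add contDiff_id).contDiffOn.absolutelyContinuousOnInterval
      ac_u := fun j => (hu j).contDiffOn.absolutelyContinuousOnInterval
      contact := fun j => Filter.Eventually.of_forall fun s => by
        rw [(hd j s).deriv, hxd, mul_one] }
  have hcont : Continuous (speed γ) := by
    have := (hu (Fin.last k)).continuous_deriv le_rfl
    unfold speed
    simp only [hxd]
    fun_prop
  -- The maximal speed on `[a, b]` serves as the Lipschitz constant.
  obtain ⟨C, hC⟩ := isCompact_Icc.exists_bound_of_continuousOn (s := Icc a b) hcont.continuousOn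
  have key : ∀ s ∈ Icc a b, ∀ r ∈ Icc a b, s ≤ r →
      edist (γ s) (γ r) ≤ (C.toNNReal : ℝ≥0∞) * edist s r := by
    intro s hs r hr hsr
    calc edist (γ s) (γ r) ≤ length γ s r := ccEDist_le hsr (hhor s r)
      _ ≤ ∫⁻ _ in Icc s r, (C.toNNReal : ℝ≥0∞) := by
          refine setLIntegral_mono measurable_const fun y hy => ?_
          exact ENNReal.ofReal_le_ofReal ((le_abs_self _).trans
            (hC y ⟨hs.1.trans hy.1, hy.2.trans hr.2⟩))
      _ = (C.toNNReal : ℝ≥0∞) * edist s r := by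
          rw [setLIntegral_const, Real.volume_Icc, edist_comm, edist_dist, Real.dist_eq,
            abs_of_nonneg (sub_nonneg.2 hsr)]
  refine ⟨C.toNNReal, fun s hs r hr => ?_⟩
  rcases le_total s r with h | h
  · exact key s hs r hr h
  · rw [edist_comm, edist_comm s r]
    exact key r hr s hs h

/-- `shift y u s` is the `s`-th derivative at `y` of the polynomial `P(y) = ∑ u_j y^j / j!`. -/
theorem hasDerivAt_shift (u : Fin (k + 1) → ℝ) (i : Fin k) (y : ℝ) :
    HasDerivAt (fun y => shift y u i.castSucc) (shift y u i.succ) y := by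
  -- The term `j = i` is constant in `y`; in all others the exponent `j - i` is positive, so
  -- differentiation lowers it by one.
  have hI : Finset.Ici i.castSucc = insert i.castSucc (Finset.Ici i.succ) := by
    ext j
    simp only [Finset.mem_Ici, Finset.mem_insert, Fin.le_def, Fin.ext_iff, Fin.val_castSucc,
      Fin.val_succ]
    omega
  have hni : i.castSucc ∉ Finset.Ici i.succ := by simp
  simp only [shift, hI, Finset.sum_insert hni, Nat.sub_self, pow_zero]
  refine HasDerivAt.const_add _ (HasDerivAt.fun_sum fun j hj => HasDerivAt.const_mul _ ?_)
  have hij : (i : ℕ) + 1 ≤ j := by simpa [Fin.le_def] using Finset.mem_Ici.1 hj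
  obtain ⟨m, hm⟩ := Nat.exists_eq_add_of_le hij
  have e1 : (j : ℕ) - (i.castSucc : ℕ) = m + 1 := by simp only [Fin.val_castSucc]; omega
  have e2 : (j : ℕ) - (i.succ : ℕ) = m := by simp only [Fin.val_succ]; omega
  rw [e1, e2]
  convert (hasDerivAt_pow (m + 1) y).div_const _ using 1
  rw [Nat.factorial_succ]
  push_cast
  have : (m.factorial : ℝ) ≠ 0 := by positivity
  field_simp

theorem contDiff_shift (u : Fin (k + 1) → ℝ) (j : Fin (k + 1)) {n : WithTop ℕ∞} :
    ContDiff ℝ n fun y => shift y u j := by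
  unfold shift
  fun_prop

/-- With `P` the polynomial whose coefficients come from `p`, the `u`-coordinates of `p ⊙ j^k_x(f)`
are the derivatives of `P + f` at `x`. The translated curve is therefore covered by the same
estimate, without using left invariance of the metric. -/
theorem exists_lipschitzOnWith_mul_jet (p : JetSpace k) {f : ℝ → ℝ} (hf : ContDiff ℝ ∞ f)
    (a b : ℝ) : ∃ K : ℝ≥0, LipschitzOnWith K (fun x => p * jet k f x) (Icc a b) := by
  have hfd : ∀ n : ℕ, ContDiff ℝ 1 (iteratedDeriv n f) := fun n =>
    iteratedDeriv_eq_iterate (𝕜 := ℝ) (f := f) (n := n) ▸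
      ContDiff.iterate_deriv' 1 n (hf.of_le (by exact_mod_cast le_top))
  refine exists_lipschitzOnWith_Icc (c := p.x) (fun s => rfl) (fun j => ?_) (fun j s => ?_) a b
  · simp only [mul_u, jet]
    exact (contDiff_shift p.u j).add (hfd j)
  · simp only [mul_u, jet, Fin.val_castSucc, Fin.val_succ, iteratedDeriv_succ]
    exact (hasDerivAt_shift p.u j s).add
      (((hfd j).differentiable one_ne_zero) s).hasDerivAt

/-! ### Projection to the base point and dimension of jet images -/

/-- The projection to the base point is `1`-Lipschitz. -/
theorem lipschitzWith_x : LipschitzWith 1 (x : JetSpace k → ℝ) := by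
  intro p q
  rw [ENNReal.coe_one, one_mul]
  refine le_of_forall_gt fun r hr => ?_
  obtain ⟨γ, a, b, hab, hγ, rfl, rfl, hlt⟩ := exists_of_ccEDist_lt hr
  rw [edist_comm, edist_eq_enorm_sub]
  exact (enorm_x_sub_le hγ (right_mem_Icc.2 hab)).trans_lt hlt

theorem _root_.IsCompact.exists_lipschitzOnWith_mul_jet {E : Set ℝ} (hE : IsCompact E)
    (p : JetSpace k) {f : ℝ → ℝ} (hf : ContDiff ℝ ∞ f) :
    ∃ K : ℝ≥0, LipschitzOnWith K (fun x => p * jet k f x) E := by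
  obtain ⟨a, ha⟩ := hE.bddBelow
  obtain ⟨b, hb⟩ := hE.bddAbove
  obtain ⟨K, hK⟩ := JetSpace.exists_lipschitzOnWith_mul_jet p hf a b
  exact ⟨K, hK.mono fun x hx => ⟨ha hx, hb hx⟩⟩

theorem dimH_jet_image {E : Set ℝ} (hE : IsCompact E) {f : ℝ → ℝ} (hf : ContDiff ℝ ∞ f) :
    dimH (jet k f '' E) = dimH E := by
  obtain ⟨K, hK⟩ := hE.exists_lipschitzOnWith_mul_jet (1 : JetSpace k) hf
  simp only [one_mul] at hK
  refine le_antisymm hK.dimH_image_le ?_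
  -- The projection maps the jet image back onto `E`, so it gives the lower bound.
  have h := lipschitzWith_x.dimH_image_le (jet k f '' E)
  rwa [image_image, show (fun s => (jet k f s).x) = id from rfl, image_id] at h

/-! ### The two mappings on the translated jet curve -/

theorem horizontalMap_mul_jet {p : JetSpace k} {t : ℝ} (hp : p ∈ plane k t) (f : ℝ → ℝ) (y : ℝ) :
    horizontalMap f t (p * jet k f y) = jet k f y := by
  have hp' : p.x = t := hp
  simp [horizontalMap, mul_x, jet, hp']

theorem verticalMap_mul_jet {p : JetSpace k} {t : ℝ} (hp : p ∈ plane k t) (f : ℝ → ℝ) (y : ℝ) :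
    verticalMap f t (p * jet k f y) = p := by
  -- By definition `V_{f,t}(q) = q ⊙ J_{f,t}(q)⁻¹`.
  change p * jet k f y * (horizontalMap f t (p * jet k f y))⁻¹ = p
  rw [horizontalMap_mul_jet hp, mul_inv_cancel_right]

end JetSpace

theorem mainTheorem6 (k : ℕ) (hk : 1 ≤ k) (t : ℝ) (f : ℝ → ℝ) (hf : ContDiff ℝ ∞ f)
    (α : ℝ) (hα0 : 0 ≤ α) (hα1 : α ≤ 1) (E : Set ℝ) (hE : IsCompact E)
    (hdim : dimH E = ENNReal.ofReal α)
    (p : JetSpace k) (hp : p ∈ JetSpace.plane k t) :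
    IsCompact ((fun x => p * JetSpace.jet k f x) '' E) ∧
    dimH (JetSpace.horizontalMap f t '' ((fun x => p * JetSpace.jet k f x) '' E)) =
      ENNReal.ofReal α ∧
    dimH (JetSpace.verticalMap f t '' ((fun x => p * JetSpace.jet k f x) '' E)) = 0 ∧
    (E.Nonempty →
      JetSpace.verticalMap f t '' ((fun x => p * JetSpace.jet k f x) '' E) = {p}) := by
  refine ⟨?_, ?_, ?_, fun hne => ?_⟩
  · obtain ⟨K, hK⟩ := hE.exists_lipschitzOnWith_mul_jet p hf
    exact hE.image_of_continuousOn hK.continuousOn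
  · simp only [image_image, JetSpace.horizontalMap_mul_jet hp]
    rw [JetSpace.dimH_jet_image hE hf, hdim]
  · simp only [image_image, JetSpace.verticalMap_mul_jet hp]
    -- Only inclusion in `{p}` is used, so that empty `E` is covered too.
    exact (subsingleton_singleton.anti (image_subset_iff.2 fun _ _ => mem_singleton p)).dimH_zero
  · simp only [image_image, JetSpace.verticalMap_mul_jet hp]
    exact hne.image_const p
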